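/- **Setting.** Let $\mathcal P$ be a finite set of processes, $\mathbb F=(\mathcal F_i)_{i\in\mathcal P}$ an asymmetric fail-prone system ($\mathcal F_i\subseteq 2^{\mathcal P}$), and $\mathbb Q=(\mathcal Q_i)_{i\in\mathcal P}$ an asymmetric Byzantine quorum system for $\mathbb F$: with $\mathcal A^*=\{A' : A'\subseteq A\in\mathcal A\}$, - (consistency) $Q_i\cap Q_j\not\subseteq F_{ij}$ for all $i,j$, $Q_i\in\mathcal Q_i$, $Q_j\in\mathcal Q_j$, $F_{ij}\in\mathcal F_i^*\cap\mathcal F_j^*$; - (availability) for all $i$ and $F_i\in\mathcal F_i$ there is $Q_i\in\mathcal Q_i$ with $F_i\cap Q_i=\emptyset$. A kernel for $i$ is a set $K\subseteq\mathcal P$ that intersects every $Q\in\mathcal Q_i$. For a set $F\subseteq\mathcal P$ of faulty processes, the processes outside $F$ are correct. Every correct process has depth $0$; a correct process $i$ has depth $d\ge 1$ if some $Q\in\mathcal Q_i$ consists only of (correct) processes of depth $d-1$. (So "depth $d$" means maximal depth at least $d$.) A correct process $i$ is naive if $F\notin\mathcal F_i^*$. Assume that, whichever set of processes is faulty, naive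 processes do not have depth $1$ (this holds, e.g., for the canonical quorum system $\mathcal Q_i=\{\mathcal P\setminus B : B\in\mathcal F_i\}$). **Algorithm** (code for $i$). Initially $\mathit{approved}=\emptyset$ and $\mathit{sentecho2}=\mathrm{false}$. A process proposes at most once, sends at most one $\mathrm{echo3}$ message and decides at most once. Values $v$ range over $\{0,1\}$, and $c\in\mathbb N$. 1. Upon bca-propose$(v)$: send $[\mathrm{echo},1,v]$ to all. 2. Upon receiving $[\mathrm{echo},c,v]$ from all members of some kernel for $i$: send $[\mathrm{echo}',c,v]$ to all. 3. Upon receiving $[\mathrm{echo}',c,v]$ from all members of some $Q\in\mathcal Q_i$: send $[\mathrm{echo},c+1,v]$ to all. 4. Upon receiving $[\mathrm{echo},c,v]$ from all members of some $Q\in\mathcal Q_i$: add $v$ to $\mathit{approved}$; if not $\mathit{sentecho2}$, send $[\mathrm{echo2},v]$ to all and set $\mathit{sentecho2}$ to true. 5. Upon receiving $[\mathrm{echo2},v]$ from all members of some $Q\in\mathcal Q_i$, or when $|\mathit{approved}|>1$: if $|\mathit{approved}|>1$ send $[\mathrm{echo3},\bot]$ to all, otherwise send $[\mathrm{echo3},v]$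 to all. 6. Upon receiving $[\mathrm{echo3},v]$ from all members of some $Q\in\mathcal Q_i$, or when $|\mathit{approved}|>1$ and $\mathrm{echo3}$ messages (with any values in $\{0,1,\bot\}$) were received from all members of some $Q\in\mathcal Q_i$: in the first case bca-decide$(v)$, otherwise bca-decide$(\bot)$. The system is asynchronous with authenticated point-to-point links; messages between correct processes are eventually delivered, correct processes eventually execute handlers that stay enabled, and faulty processes may send arbitrary messages to anyone at any time. **Lemma.** For every set $F\subseteq\mathcal P$ of faulty processes, the algorithm solves asymmetric binding crusader agreement $\mathrm{BCA}[2,6]$, that is: - *Termination.* If all processes with depth $2$ bca-propose a value, then every process with depth $6$ eventually bca-decides. - *Validity.* If all processes with depth $2$ bca-propose the same value $v$, then no process with depth $6$ bca-decides anything but $v$. - *Agreement.* If two processes with depth $6$ bca-decide $v$ and $v'$, then $v=v'$ or one of the two values is $\bot$. - *Binding.* If $\tau$ is the first time at which some process with depth $6$ bca-decides, then at time $\tau$ there is a value $b\in\{0,1\}$ such that no process with depth $6$ bca-decides $1-b$ in any extension of this execution beyond time $\tau$. -/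

import Mathlib

/-! ## Asymmetric quorum systems and depth -/

/-- `downClosure A` is the collection of all subsets of the members of `A`. -/
def downClosure {P : Type*} (A : Set (Set P)) : Set (Set P) :=
  {B | ∃ C ∈ A, B ⊆ C}

/-- `Q` is an asymmetric Byzantine quorum system for the asymmetric fail-prone system `Fp`
(`Fp i` are the fail-prone sets, `Q i` the quorums of process `i`). -/
structure IsAsymQuorumSystem {P : Type*} (Fp Q : P → Set (Set P)) : Prop where
  consistency : ∀ i j, ∀ qi ∈ Q i, ∀ qj ∈ Q j, ∀ B ∈ downClosure (Fp i) ∩ downClosure (Fp j),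
    ¬ (qi ∩ qj ⊆ B)
  availability : ∀ i, ∀ B ∈ Fp i, ∃ q ∈ Q i, B ∩ q = ∅

/-- `K` is a kernel for a process whose quorums are the members of `Qi`. -/
def IsKernel {P : Type*} (Qi : Set (Set P)) (K : Set P) : Prop :=
  ∀ q ∈ Qi, (K ∩ q).Nonempty

/-- `i` is naive when `F` is the set of faulty processes: it is correct but does not foresee `F`. -/
def IsNaive {P : Type*} (Fp : P → Set (Set P)) (F : Set P) (i : P) : Prop :=
  i ∉ F ∧ F ∉ downClosure (Fp i)

/-- `HasDepth Q F d i`: process `i` has depth `d` when `F` is the set of faulty processes.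
That the maximal depth of `i` is at least `d` means the same. -/
def HasDepth {P : Type*} (Q : P → Set (Set P)) (F : Set P) : ℕ → P → Prop
  | 0, i => i ∉ F
  | d + 1, i => i ∉ F ∧ ∃ q ∈ Q i, ∀ j ∈ q, HasDepth Q F d j

/-! ## The binding crusader agreement algorithm

Binary values are of type `Bool`; `none : Option Bool` is the value `⊥`. -/

/-- Protocol messages. -/
inductive Msg : Type
  | echo (c : ℕ) (v : Bool)
  | echoPrime (c : ℕ) (v : Bool)
  | echo2 (v : Bool)
  | echo3 (w : Option Bool)

/-- Local state of a process. The fields `input`, `received`, `sent` and `decision` record the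
proposal, the messages received so far (with their authenticated sender), the messages sent so far
(each message is sent to all processes) and the decision. -/
structure LocalState (P : Type*) where
  input : Option Bool
  received : Set (P × Msg)
  sent : Set Msg
  approved : Finset Bool
  sentEcho2 : Bool
  sentEcho3 : Bool
  decision : Option (Option Bool)

/-- The state in which every process starts. -/
def LocalState.start (P : Type*) : LocalState P where
  input := none
  received := ∅
  sent := ∅
  approved := ∅
  sentEcho2 := false
  sentEcho3 := false
  decision := none

/-- `m` was received from all members of some quorum. -/
def LocalState.FromQuorum {P : Type*} (Qi : Set (Set P)) (s : LocalState P) (m : Msg) : Prop :=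
  ∃ q ∈ Qi, ∀ j ∈ q, (j, m) ∈ s.received

/-- `m` was received from all members of some kernel. -/
def LocalState.FromKernel {P : Type*} (Qi : Set (Set P)) (s : LocalState P) (m : Msg) : Prop :=
  ∃ K, IsKernel Qi K ∧ ∀ j ∈ K, (j, m) ∈ s.received

/-- Some `echo3` message, with whatever value, was received from each member of some quorum. -/
def LocalState.AnyEcho3FromQuorum {P : Type*} (Qi : Set (Set P)) (s : LocalState P) : Prop :=
  ∃ q ∈ Qi, ∀ j ∈ q, ∃ w, (j, Msg.echo3 w) ∈ s.received

/-- The message handlers of the algorithm (with the values of their variables). -/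
inductive Rule : Type
  | echoKernel (c : ℕ) (v : Bool)
  | echoPrimeQuorum (c : ℕ) (v : Bool)
  | echoQuorum (c : ℕ) (v : Bool)
  | echo2Quorum (v : Bool)
  | decideValue (v : Bool)
  | decideBot

/-- The condition under which a handler may be executed. A process sends at most one `echo3`
message and decides at most once; executing another handler again changes nothing. -/
def Rule.Guard {P : Type*} (Qi : Set (Set P)) (s : LocalState P) : Rule → Prop
  | .echoKernel c v => s.FromKernel Qi (.echo c v)
  | .echoPrimeQuorum c v => s.FromQuorum Qi (.echoPrime c v)
  | .echoQuorum c v => s.FromQuorum Qi (.echo c v)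
  | .echo2Quorum v =>
      s.sentEcho3 = false ∧ (s.FromQuorum Qi (.echo2 v) ∨ 1 < s.approved.card)
  | .decideValue v => s.decision = none ∧ s.FromQuorum Qi (.echo3 (some v))
  | .decideBot =>
      s.decision = none ∧ 1 < s.approved.card ∧ s.AnyEcho3FromQuorum Qi ∧
        ¬ ∃ v : Bool, s.FromQuorum Qi (.echo3 (some v))

/-- The state after a handler was executed. -/
def Rule.apply {P : Type*} (s : LocalState P) : Rule → LocalState P
  | .echoKernel c v => { s with sent := insert (.echoPrime c v) s.sent }
  | .echoPrimeQuorum c v => { s with sent := insert (.echo (c + 1) v) s.sent }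
  | .echoQuorum _ v =>
      { s with
        approved := insert v s.approved
        sent := if s.sentEcho2 = false then insert (.echo2 v) s.sent else s.sent
        sentEcho2 := true }
  | .echo2Quorum v =>
      { s with
        sent := insert (.echo3 (if 1 < s.approved.card then none else some v)) s.sent
        sentEcho3 := true }
  | .decideValue v => { s with decision := some (some v) }
  | .decideBot => { s with decision := some none }

/-- What can happen at a process: it proposes, it receives a message, it executes a handler. -/
inductive LocalEvent (P : Type*) : Type _
  | propose (v : Bool)
  | receive (j : P) (m : Msg)
  | fire (r : Rule)

/-- LocalEvent `a` is possible at process `i`. Only the sender `j` can originate a message from `j`: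
a correct `j` must have sent it, a faulty `j` can send any message to anyone at any time. -/
def LocalEvent.Enabled {P : Type*} (Q : P → Set (Set P)) (F : Set P) (σ : P → LocalState P) (i : P) :
    LocalEvent P → Prop
  | .propose _ => (σ i).input = none
  | .receive j m => j ∈ F ∨ m ∈ (σ j).sent
  | .fire r => r.Guard (Q i) (σ i)

/-- The local state after an action. -/
def LocalEvent.apply {P : Type*} (s : LocalState P) : LocalEvent P → LocalState P
  | .propose v => { s with input := some v, sent := insert (.echo 1 v) s.sent }
  | .receive j m => { s with received := insert (j, m) s.received }
  | .fire r => r.apply s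

/-- An asynchronous execution with set of faulty processes `F`: at each time, at most one correct
process takes a step. (The states of faulty processes are not tracked; their behaviour consists
of the messages that correct processes receive from them.) -/
structure Execution {P : Type*} (Q : P → Set (Set P)) (F : Set P) where
  conf : ℕ → P → LocalState P
  event : ℕ → Option (P × LocalEvent P)
  conf_zero : ∀ i, conf 0 i = LocalState.start P
  idle : ∀ t, event t = none → conf (t + 1) = conf t
  step : ∀ t i a, event t = some (i, a) →
    i ∉ F ∧ a.Enabled Q F (conf t) i ∧ conf (t + 1) i = a.apply (conf t i) ∧
      ∀ j, j ≠ i → conf (t + 1) j = conf t j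

/-- The liveness assumptions of the asynchronous model: messages between correct processes are
eventually delivered, and a correct process eventually executes a handler that stays enabled. -/
structure Execution.Fair {P : Type*} {Q : P → Set (Set P)} {F : Set P} (e : Execution Q F) :
    Prop where
  delivery : ∀ i j m t, i ∉ F → j ∉ F → m ∈ (e.conf t j).sent →
    ∃ t', (j, m) ∈ (e.conf t' i).received
  progress : ∀ i (r : Rule) t, i ∉ F → r.Guard (Q i) (e.conf t i) →
    ∃ t' ≥ t, e.event t' = some (i, .fire r) ∨ ¬ r.Guard (Q i) (e.conf t' i)

/-- Process `i` bca-proposes `v` in `e`. -/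
def Execution.Proposes {P : Type*} {Q : P → Set (Set P)} {F : Set P} (e : Execution Q F)
    (i : P) (v : Bool) : Prop :=
  ∃ t, (e.conf t i).input = some v

/-- Process `i` has bca-decided `w` by time `t` in `e`. -/
def Execution.DecidedBy {P : Type*} {Q : P → Set (Set P)} {F : Set P} (e : Execution Q F)
    (t : ℕ) (i : P) (w : Option Bool) : Prop :=
  (e.conf t i).decision = some w

/-- Process `i` bca-decides `w` in `e`. -/
def Execution.Decides {P : Type*} {Q : P → Set (Set P)} {F : Set P} (e : Execution Q F)
    (i : P) (w : Option Bool) : Prop :=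
  ∃ t, e.DecidedBy t i w

/-- `τ` is the first time at which a process with depth `d` has bca-decided. -/
def Execution.IsFirstDecision {P : Type*} {Q : P → Set (Set P)} {F : Set P} (e : Execution Q F)
    (d τ : ℕ) : Prop :=
  (∃ i w, HasDepth Q F d i ∧ e.DecidedBy τ i w) ∧
    ∀ t < τ, ∀ i w, HasDepth Q F d i → ¬ e.DecidedBy t i w

/-- `e'` is an extension of the part of `e` up to time `τ`. -/
def Execution.Extends {P : Type*} {Q : P → Set (Set P)} {F : Set P} (e' e : Execution Q F)
    (τ : ℕ) : Prop :=
  (∀ t ≤ τ, e'.conf t = e.conf t) ∧ ∀ t < τ, e'.event t = e.event t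

/-- The algorithm solves depth-characterized asymmetric binding crusader agreement with depths
`d'` (proposing processes) and `d` (deciding processes) when `F` is the set of faulty processes.
The safety properties are required in all executions, fair or not. -/
structure SolvesBCA {P : Type*} (Q : P → Set (Set P)) (F : Set P) (d' d : ℕ) : Prop where
  termination : ∀ e : Execution Q F, e.Fair →
    (∀ i, HasDepth Q F d' i → ∃ v, e.Proposes i v) →
    ∀ i, HasDepth Q F d i → ∃ w, e.Decides i w
  validity : ∀ (e : Execution Q F) (v : Bool),
    (∀ i, HasDepth Q F d' i → e.Proposes i v) →
    ∀ i w, HasDepth Q F d i → e.Decides i w → w = some v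
  agreement : ∀ (e : Execution Q F) i j w w', HasDepth Q F d i → HasDepth Q F d j →
    e.Decides i w → e.Decides j w' → w = w' ∨ w = none ∨ w' = none
  binding : ∀ (e : Execution Q F) (τ : ℕ), e.IsFirstDecision d τ →
    ∃ b : Bool, ∀ e' : Execution Q F, e'.Extends e τ →
      ∀ i, HasDepth Q F d i → ¬ e'.Decides i (some (!b))

/-! ## Depth and quorum intersection -/

section Depth

variable {P : Type*} {Fp Q : P → Set (Set P)} {F : Set P}

/-! Everything rests on one change of viewpoint: declare all processes without depth `d` faulty. A
process of depth `d + 1` has depth `1` for this enlarged fault set, so it is not naive and foresees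
it. Consistency then makes quorums of two such processes meet in a process of depth `d`
(`exists_hasDepth_mem_inter`).

Safety: no correct process sends two different `echo2` or `echo3` messages, so quorum intersection
gives agreement, and forces all non-`⊥` `echo3` values sent at positive depth to coincide. A
decision on `⊥` rests on a quorum of `echo3` messages already sent, which any later decision must
meet; this is binding. For validity, a value not proposed at depth `2` can never enter an `echo`
message at depth `2`.

Liveness: some value is proposed by a kernel for every process of depth `3`, and each round of
messages costs one level of depth, so it is approved at depth `5`. Conversely,
`approves_of_approves` carries any approval at positive depth to all of depth `3`. Either both
values are approved at depth `3`, or only one is ever approved at positive depth; both cases lead to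
decisions. -/

theorem HasDepth.correct {d : ℕ} {i : P} (h : HasDepth Q F d i) : i ∉ F := by
  cases d with
  | zero => exact h
  | succ d => exact h.1

theorem HasDepth.of_succ {d : ℕ} {i : P} (h : HasDepth Q F (d + 1) i) : HasDepth Q F d i := by
  induction d generalizing i with
  | zero => exact h.1
  | succ d ih =>
    obtain ⟨hi, q, hq, hqd⟩ := h
    exact ⟨hi, q, hq, fun j hj => ih (hqd j hj)⟩

theorem HasDepth.mono {d d' : ℕ} (hd : d ≤ d') {i : P} (h : HasDepth Q F d' i) :
    HasDepth Q F d i := by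
  induction hd with
  | refl => exact h
  | step _ ih => exact ih h.of_succ

/-- A process of depth `d + 1` foresees the failure of all processes that do not have depth `d`. -/
theorem HasDepth.compl_mem_downClosure
    (hnaive : ∀ (B : Set P) (i : P), IsNaive Fp B i → ¬ HasDepth Q B 1 i)
    {d : ℕ} {i : P} (h : HasDepth Q F (d + 1) i) :
    {j | HasDepth Q F d j}ᶜ ∈ downClosure (Fp i) := by
  by_contra hB
  have hi : i ∉ {j | HasDepth Q F d j}ᶜ := fun hc => hc h.of_succ
  obtain ⟨-, q, hq, hqd⟩ := h
  -- The fault set here is the set of processes without depth `d`, not `F`; this is why non-naivety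
  -- is assumed for every fault set.
  exact hnaive _ i ⟨hi, hB⟩ ⟨hi, q, hq, fun j hj hc => hc (hqd j hj)⟩

/-- Quorums of two processes of depth `d + 1` have a process of depth `d` in common. -/
theorem IsAsymQuorumSystem.exists_hasDepth_mem_inter (hQ : IsAsymQuorumSystem Fp Q)
    (hnaive : ∀ (B : Set P) (i : P), IsNaive Fp B i → ¬ HasDepth Q B 1 i)
    {d : ℕ} {i j : P} (hi : HasDepth Q F (d + 1) i) (hj : HasDepth Q F (d + 1) j)
    {q q' : Set P} (hq : q ∈ Q i) (hq' : q' ∈ Q j) :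
    ∃ x, x ∈ q ∧ x ∈ q' ∧ HasDepth Q F d x := by
  obtain ⟨x, hx, hxd⟩ := Set.not_subset.1 (hQ.consistency i j q hq q' hq' _
    ⟨hi.compl_mem_downClosure hnaive, hj.compl_mem_downClosure hnaive⟩)
  exact ⟨x, hx.1, hx.2, not_not.1 hxd⟩

end Depth

/-! ## Invariants of the local states -/

section Invariants

variable {P : Type*} {Q : P → Set (Set P)} {F : Set P}

theorem LocalState.FromQuorum.mono {Qi : Set (Set P)} {s s' : LocalState P} {m : Msg}
    (h : s.FromQuorum Qi m) (hs : s.received ⊆ s'.received) : s'.FromQuorum Qi m := by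
  obtain ⟨q, hq, hm⟩ := h
  exact ⟨q, hq, fun j hj => hs (hm j hj)⟩

theorem LocalState.FromKernel.mono {Qi : Set (Set P)} {s s' : LocalState P} {m : Msg}
    (h : s.FromKernel Qi m) (hs : s.received ⊆ s'.received) : s'.FromKernel Qi m := by
  obtain ⟨K, hK, hm⟩ := h
  exact ⟨K, hK, fun j hj => hs (hm j hj)⟩

theorem LocalState.AnyEcho3FromQuorum.mono {Qi : Set (Set P)} {s s' : LocalState P}
    (h : s.AnyEcho3FromQuorum Qi) (hs : s.received ⊆ s'.received) :
    s'.AnyEcho3FromQuorum Qi := by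
  obtain ⟨q, hq, hm⟩ := h
  exact ⟨q, hq, fun j hj => (hm j hj).imp fun w hw => hs hw⟩

/-- The information in a local state only grows. -/
structure LocalState.Le (s s' : LocalState P) : Prop where
  received : s.received ⊆ s'.received
  sent : s.sent ⊆ s'.sent
  approved : s.approved ⊆ s'.approved
  input : ∀ v, s.input = some v → s'.input = some v

theorem LocalState.Le.refl (s : LocalState P) : s.Le s :=
  ⟨subset_rfl, subset_rfl, subset_rfl, fun _ => id⟩

theorem LocalState.Le.trans {s s' s'' : LocalState P} (h : s.Le s') (h' : s'.Le s'') :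
    s.Le s'' where
  received := h.received.trans h'.received
  sent := h.sent.trans h'.sent
  approved := h.approved.trans h'.approved
  input v hv := h'.input v (h.input v hv)

/-- Only a proposal could overwrite recorded information, and its guard requires that there is no
input yet. -/
theorem LocalEvent.Enabled.le_apply {σ : P → LocalState P} {i : P} {a : LocalEvent P}
    (h : a.Enabled Q F σ i) : (σ i).Le (a.apply (σ i)) := by
  generalize hs : σ i = s at *
  cases a with
  | propose v =>
    simp only [LocalEvent.Enabled, hs] at h
    constructor <;> simp_all [LocalEvent.apply]
  | receive j m => constructor <;> simp_all [LocalEvent.apply]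
  | fire r =>
    simp only [LocalEvent.Enabled, hs] at h
    cases r <;> constructor <;> simp_all [LocalEvent.apply, Rule.apply, Rule.Guard]
    split_ifs <;> simp

/-- The reasons that a process has for its actions. -/
structure LocalState.Valid (Qi : Set (Set P)) (s : LocalState P) : Prop where
  input : ∀ v, s.input = some v → .echo 1 v ∈ s.sent
  echo : ∀ c v, .echo c v ∈ s.sent →
    (c = 1 ∧ s.input = some v) ∨ ∃ c', c = c' + 1 ∧ s.FromQuorum Qi (.echoPrime c' v)
  echoPrime : ∀ c v, .echoPrime c v ∈ s.sent → s.FromKernel Qi (.echo c v)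
  approved : ∀ v ∈ s.approved, ∃ c, s.FromQuorum Qi (.echo c v)
  echo2 : ∀ v, .echo2 v ∈ s.sent → v ∈ s.approved ∧ s.sentEcho2 = true
  sentEcho2 : ∀ v ∈ s.approved, ∃ u, .echo2 u ∈ s.sent
  sentEcho2' : s.sentEcho2 = true → s.approved.Nonempty
  echo2_unique : ∀ v v', .echo2 v ∈ s.sent → .echo2 v' ∈ s.sent → v = v'
  echo3 : ∀ w, .echo3 w ∈ s.sent → s.sentEcho3 = true
  sentEcho3 : s.sentEcho3 = true → ∃ w, .echo3 w ∈ s.sent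
  echo3_unique : ∀ w w', .echo3 w ∈ s.sent → .echo3 w' ∈ s.sent → w = w'
  echo3_some : ∀ v, .echo3 (some v) ∈ s.sent → s.FromQuorum Qi (.echo2 v)
  echo3_none : .echo3 none ∈ s.sent → 1 < s.approved.card
  decision_some : ∀ v, s.decision = some (some v) → s.FromQuorum Qi (.echo3 (some v))
  decision_none : s.decision = some none → 1 < s.approved.card ∧ s.AnyEcho3FromQuorum Qi

/-! ### Preservation of the local invariant -/

theorem LocalState.Valid.start (Qi : Set (Set P)) : (LocalState.start P).Valid Qi := by
  constructor <;> simp [LocalState.start]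

theorem LocalState.Valid.apply_propose {Qi : Set (Set P)} {s : LocalState P} (hs : s.Valid Qi)
    {v : Bool} (h : s.input = none) : ((LocalEvent.propose v).apply s).Valid Qi where
  input := by simp [LocalEvent.apply]
  echo c u hu := by
    simp only [LocalEvent.apply, Set.mem_insert_iff, Msg.echo.injEq] at hu
    rcases hu with ⟨rfl, rfl⟩ | hu
    · exact .inl ⟨rfl, rfl⟩
    · rcases hs.echo c u hu with ⟨-, h'⟩ | h'
      · simp [h] at h'
      · exact .inr h'
  echoPrime c u hu := hs.echoPrime c u (by simpa [LocalEvent.apply] using hu)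
  approved := hs.approved
  echo2 u hu := hs.echo2 u (by simpa [LocalEvent.apply] using hu)
  sentEcho2 u hu := (hs.sentEcho2 u hu).imp fun _ h => .inr h
  sentEcho2' := hs.sentEcho2'
  echo2_unique u u' hu hu' := hs.echo2_unique u u' (by simpa [LocalEvent.apply] using hu)
    (by simpa [LocalEvent.apply] using hu')
  echo3 u hu := hs.echo3 u (by simpa [LocalEvent.apply] using hu)
  sentEcho3 hu := (hs.sentEcho3 hu).imp fun _ h => .inr h
  echo3_unique u u' hu hu' := hs.echo3_unique u u' (by simpa [LocalEvent.apply] using hu)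
    (by simpa [LocalEvent.apply] using hu')
  echo3_some u hu := hs.echo3_some u (by simpa [LocalEvent.apply] using hu)
  echo3_none hu := hs.echo3_none (by simpa [LocalEvent.apply] using hu)
  decision_some := hs.decision_some
  decision_none := hs.decision_none

theorem LocalState.Valid.apply_receive {Qi : Set (Set P)} {s : LocalState P} (hs : s.Valid Qi)
    (j : P) (m : Msg) : ((LocalEvent.receive j m).apply s).Valid Qi := by
  have hsub : s.received ⊆ ((LocalEvent.receive j m).apply s).received := Set.subset_insert _ _
  exact
    { hs with
      echo := fun c v hv => (hs.echo c v hv).imp_right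
        fun ⟨c', hc', h⟩ => ⟨c', hc', h.mono hsub⟩
      echoPrime := fun c v hv => (hs.echoPrime c v hv).mono hsub
      approved := fun v hv => (hs.approved v hv).imp fun _ h => h.mono hsub
      echo3_some := fun v hv => (hs.echo3_some v hv).mono hsub
      decision_some := fun v hv => (hs.decision_some v hv).mono hsub
      decision_none := fun h => (hs.decision_none h).imp_right fun h => h.mono hsub }

theorem LocalState.Valid.apply_echoQuorum {Qi : Set (Set P)} {s : LocalState P}
    (hs : s.Valid Qi) {c : ℕ} {v : Bool} (h : (Rule.echoQuorum c v).Guard Qi s) :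
    ((Rule.echoQuorum c v).apply s).Valid Qi := by
  have hsub : s.approved ⊆ insert v s.approved := Finset.subset_insert _ _
  have hmem : ∀ m, m ∈ ((Rule.echoQuorum c v).apply s).sent ↔
      m ∈ s.sent ∨ (s.sentEcho2 = false ∧ m = .echo2 v) := by
    intro m
    simp only [Rule.apply]
    split_ifs with h2 <;> simp [h2, or_comm]
  constructor <;> try simp only [hmem]
  case input => exact fun u hu => .inl (hs.input u hu)
  case echo => intro c' u hu; exact hs.echo c' u (by simpa using hu)
  case echoPrime => intro c' u hu; exact hs.echoPrime c' u (by simpa using hu)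
  case approved =>
    intro u hu
    rcases Finset.mem_insert.1 hu with rfl | hu
    · exact ⟨c, h⟩
    · exact hs.approved u hu
  case echo2 =>
    rintro u (hu | ⟨-, hu⟩)
    · exact ⟨hsub (hs.echo2 u hu).1, rfl⟩
    · exact ⟨by simp_all [Rule.apply], rfl⟩
  case sentEcho2 =>
    intro u hu
    cases h2 : s.sentEcho2 with
    | false => exact ⟨v, .inr ⟨rfl, rfl⟩⟩
    | true =>
      -- The newly approved value causes no message here, so an `echo2` message must come from an
      -- earlier approval; `sentEcho2'` makes the invariant inductive.
      obtain ⟨x, hx⟩ := hs.sentEcho2' h2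
      exact (hs.sentEcho2 x hx).imp fun _ => .inl
  case sentEcho2' => exact fun _ => ⟨v, Finset.mem_insert_self _ _⟩
  case echo2_unique =>
    rintro u u' (hu | ⟨h2, hu⟩) (hu' | ⟨h2', hu'⟩)
    · exact hs.echo2_unique u u' hu hu'
    · simp [(hs.echo2 u hu).2] at h2'
    · simp [(hs.echo2 u' hu').2] at h2
    · simp_all
  case echo3 => intro w hw; exact hs.echo3 w (by simpa using hw)
  case sentEcho3 => exact fun hw => (hs.sentEcho3 hw).imp fun _ => .inl
  case echo3_unique =>
    intro w w' hw hw'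
    exact hs.echo3_unique w w' (by simpa using hw) (by simpa using hw')
  case echo3_some => intro u hu; exact hs.echo3_some u (by simpa using hu)
  case echo3_none =>
    intro hw
    exact (hs.echo3_none (by simpa using hw)).trans_le (Finset.card_le_card hsub)
  case decision_some => exact hs.decision_some
  case decision_none =>
    exact fun hd => ⟨(hs.decision_none hd).1.trans_le (Finset.card_le_card hsub),
      (hs.decision_none hd).2⟩

theorem LocalState.Valid.apply_echo2Quorum {Qi : Set (Set P)} {s : LocalState P}
    (hs : s.Valid Qi) {v : Bool} (h : (Rule.echo2Quorum v).Guard Qi s) :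
    ((Rule.echo2Quorum v).apply s).Valid Qi := by
  obtain ⟨h3, h⟩ := h
  have hno : ∀ w, .echo3 w ∉ s.sent := fun w hw => by simp [hs.echo3 w hw] at h3
  constructor <;> simp only [Rule.apply, Set.mem_insert_iff, reduceCtorEq, false_or]
  case input => exact hs.input
  case echo => exact hs.echo
  case echoPrime => exact hs.echoPrime
  case approved => exact hs.approved
  case echo2 => exact hs.echo2
  case sentEcho2 => exact hs.sentEcho2
  case sentEcho2' => exact hs.sentEcho2'
  case echo2_unique => exact hs.echo2_unique
  case echo3 => exact fun _ _ => trivial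
  case sentEcho3 => exact fun _ => ⟨_, .inl rfl⟩
  case echo3_unique => simp_all
  case echo3_some =>
    intro u hu
    simp only [hno, or_false, Msg.echo3.injEq] at hu
    split_ifs at hu with hc
    simp only [Option.some.injEq] at hu
    exact hu ▸ h.resolve_right hc
  case echo3_none =>
    intro hu
    simp only [hno, or_false, Msg.echo3.injEq] at hu
    split_ifs at hu with hc
    exact hc
  case decision_some => exact hs.decision_some
  case decision_none => exact hs.decision_none

theorem LocalState.Valid.apply_fire {Qi : Set (Set P)} {s : LocalState P} (hs : s.Valid Qi)
    {r : Rule} (h : r.Guard Qi s) : (r.apply s).Valid Qi := by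
  cases r with
  | echoKernel c v =>
    constructor <;> simp only [Rule.apply, Set.mem_insert_iff, reduceCtorEq, false_or]
    case echoPrime =>
      rintro c' u (hu | hu)
      · cases hu
        exact h
      · exact hs.echoPrime c' u hu
    case sentEcho2 => exact hs.sentEcho2
    case sentEcho3 => exact hs.sentEcho3
    exacts [hs.input, hs.echo, hs.approved, hs.echo2, hs.sentEcho2', hs.echo2_unique, hs.echo3,
      hs.echo3_unique, hs.echo3_some, hs.echo3_none, hs.decision_some, hs.decision_none]
  | echoPrimeQuorum c v =>
    constructor <;> simp only [Rule.apply, Set.mem_insert_iff, reduceCtorEq, false_or]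
    case input => exact fun u hu => .inr (hs.input u hu)
    case echo =>
      rintro c' u (hu | hu)
      · cases hu
        exact .inr ⟨c, rfl, h⟩
      · exact hs.echo c' u hu
    case sentEcho2 => exact hs.sentEcho2
    case sentEcho3 => exact hs.sentEcho3
    exacts [hs.echoPrime, hs.approved, hs.echo2, hs.sentEcho2', hs.echo2_unique, hs.echo3,
      hs.echo3_unique, hs.echo3_some, hs.echo3_none, hs.decision_some, hs.decision_none]
  | echoQuorum c v => exact hs.apply_echoQuorum h
  | echo2Quorum v => exact hs.apply_echo2Quorum h
  | decideValue v =>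
    exact
      { hs with
        decision_some := fun u hu => by
          simp only [Rule.apply, Option.some.injEq] at hu
          exact hu ▸ h.2
        decision_none := fun hu => by simp [Rule.apply] at hu }
  | decideBot =>
    exact
      { hs with
        decision_some := fun u hu => by simp [Rule.apply] at hu
        decision_none := fun _ => ⟨h.2.1, h.2.2.1⟩ }

theorem LocalState.Valid.apply_event {σ : P → LocalState P} {i : P} (hs : (σ i).Valid (Q i))
    {a : LocalEvent P} (h : a.Enabled Q F σ i) : (a.apply (σ i)).Valid (Q i) := by
  cases a with
  | propose v => exact hs.apply_propose h
  | receive j m => exact hs.apply_receive j m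
  | fire r => exact hs.apply_fire h

end Invariants

/-! ## Executions -/

section Executions

variable {P : Type*} {Fp Q : P → Set (Set P)} {F : Set P}

namespace Execution

/-! ### Monotonicity and provenance of messages in executions -/

theorem conf_succ_cases (e : Execution Q F) (t : ℕ) (i : P) :
    e.conf (t + 1) i = e.conf t i ∨
      ∃ a : LocalEvent P, a.Enabled Q F (e.conf t) i ∧
        e.conf (t + 1) i = a.apply (e.conf t i) := by
  rcases h : e.event t with _ | ⟨j, a⟩
  · exact .inl (by rw [e.idle t h])
  · obtain ⟨-, ha, hj, hne⟩ := e.step t j a h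
    by_cases hij : i = j
    · subst hij
      exact .inr ⟨a, ha, hj⟩
    · exact .inl (hne i hij)

theorem conf_le (e : Execution Q F) (i : P) {t t' : ℕ} (h : t ≤ t') :
    (e.conf t i).Le (e.conf t' i) := by
  induction h with
  | refl => exact .refl _
  | @step n _ ih =>
    refine ih.trans ?_
    rcases e.conf_succ_cases n i with h | ⟨a, ha, h⟩ <;> rw [Nat.succ_eq_add_one, h]
    · exact .refl _
    · exact ha.le_apply

theorem valid (e : Execution Q F) (t : ℕ) (i : P) : (e.conf t i).Valid (Q i) := by
  induction t with
  | zero => rw [e.conf_zero]; exact .start _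
  | succ n ih =>
    rcases e.conf_succ_cases n i with h | ⟨a, ha, h⟩ <;> rw [h]
    · exact ih
    · exact ih.apply_event ha

theorem mem_sent_of_mem_received (e : Execution Q F) {t : ℕ} {i j : P} {m : Msg} (hj : j ∉ F)
    (h : (j, m) ∈ (e.conf t i).received) : m ∈ (e.conf t j).sent := by
  induction t with
  | zero => simp [e.conf_zero, LocalState.start] at h
  | succ n ih =>
    apply (e.conf_le j n.le_succ).sent
    rcases e.conf_succ_cases n i with h' | ⟨a, ha, h'⟩ <;> rw [h'] at h
    · exact ih h
    · cases a with
      | propose v => exact ih h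
      | receive k m' =>
        rcases h with h | h
        · cases h
          exact ha.resolve_left hj
        · exact ih h
      | fire r => cases r <;> exact ih h

/-- The depth of the sender comes from `k`, not from the receiver `i`: the two quorums share a
correct process, and `k` has a quorum all of whose members have depth `d`. -/
theorem exists_hasDepth_sent_of_fromQuorum (hQ : IsAsymQuorumSystem Fp Q)
    (hnaive : ∀ (B : Set P) (i : P), IsNaive Fp B i → ¬ HasDepth Q B 1 i)
    (e : Execution Q F) {d t : ℕ} {i k : P} (hi : HasDepth Q F 1 i)
    (hk : HasDepth Q F (d + 1) k) {m : Msg} (h : (e.conf t i).FromQuorum (Q i) m) :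
    ∃ j, HasDepth Q F d j ∧ m ∈ (e.conf t j).sent := by
  obtain ⟨q, hq, hm⟩ := h
  obtain ⟨hkF, q', hq', hd⟩ := hk
  obtain ⟨x, hx, hx', hxF⟩ := hQ.exists_hasDepth_mem_inter hnaive hi
    (HasDepth.mono (Nat.le_add_left 1 d) ⟨hkF, q', hq', hd⟩) hq hq'
  exact ⟨x, hd x hx', e.mem_sent_of_mem_received hxF (hm x hx)⟩

theorem exists_hasDepth_sent_of_fromKernel (e : Execution Q F) {d t : ℕ} {i : P}
    (hi : HasDepth Q F (d + 1) i) {m : Msg} (h : (e.conf t i).FromKernel (Q i) m) :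
    ∃ j, HasDepth Q F d j ∧ m ∈ (e.conf t j).sent := by
  obtain ⟨K, hK, hm⟩ := h
  obtain ⟨-, q, hq, hd⟩ := hi
  obtain ⟨x, hxK, hxq⟩ := hK q hq
  exact ⟨x, hd x hxq, e.mem_sent_of_mem_received (hd x hxq).correct (hm x hxK)⟩

/-- If two processes of positive depth received messages from quorums, then some correct process
sent both messages. -/
theorem exists_sent_of_fromQuorum_of_fromQuorum (hQ : IsAsymQuorumSystem Fp Q)
    (hnaive : ∀ (B : Set P) (i : P), IsNaive Fp B i → ¬ HasDepth Q B 1 i)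
    (e : Execution Q F) {t t' : ℕ} {i j : P} (hi : HasDepth Q F 1 i) (hj : HasDepth Q F 1 j)
    {m m' : Msg} (h : (e.conf t i).FromQuorum (Q i) m)
    (h' : (e.conf t' j).FromQuorum (Q j) m') :
    ∃ x T, m ∈ (e.conf T x).sent ∧ m' ∈ (e.conf T x).sent := by
  obtain ⟨q, hq, hm⟩ := h
  obtain ⟨q', hq', hm'⟩ := h'
  obtain ⟨x, hx, hx', hxF⟩ := hQ.exists_hasDepth_mem_inter hnaive hi hj hq hq'
  exact ⟨x, max t t',
    (e.conf_le x (le_max_left _ _)).sent (e.mem_sent_of_mem_received hxF (hm x hx)),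
    (e.conf_le x (le_max_right _ _)).sent (e.mem_sent_of_mem_received hxF (hm' x hx'))⟩

theorem input_eq (e : Execution Q F) {t t' : ℕ} {i : P} {v v' : Bool}
    (h : (e.conf t i).input = some v) (h' : (e.conf t' i).input = some v') : v = v' := by
  have h1 := (e.conf_le i (le_max_left t t')).input v h
  have h2 := (e.conf_le i (le_max_right t t')).input v' h'
  simpa [h1] using h2

/-! ### Safety -/

/-- Induction on the round. A quorum of `echo'` messages contains a sender of depth `3`, thanks to
`k`; the kernel that prompted it meets its quorum of depth-`2` processes, which gives an earlier
`echo` at depth `2`. -/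
theorem echo_not_mem_sent_of_proposes (hQ : IsAsymQuorumSystem Fp Q)
    (hnaive : ∀ (B : Set P) (i : P), IsNaive Fp B i → ¬ HasDepth Q B 1 i)
    (e : Execution Q F) {k : P} (hk : HasDepth Q F 4 k) {v u : Bool} (hu : u ≠ v)
    (hp : ∀ i, HasDepth Q F 2 i → e.Proposes i v) (c t : ℕ) (i : P) (hi : HasDepth Q F 2 i) :
    .echo c u ∉ (e.conf t i).sent := by
  induction c generalizing t i with
  -- Proposals use round `1` and later rounds are successors, so correct processes send nothing in
  -- round `0`.
  | zero => intro h; simpa using (e.valid t i).echo 0 u h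
  | succ c ih =>
    intro h
    rcases (e.valid t i).echo _ u h with ⟨-, hin⟩ | ⟨c', hc, hq⟩
    · obtain ⟨t', ht'⟩ := hp i hi
      exact hu (e.input_eq hin ht')
    · cases hc
      obtain ⟨j, hj, hs⟩ := e.exists_hasDepth_sent_of_fromQuorum hQ hnaive hi.of_succ hk hq
      obtain ⟨x, hx, hxs⟩ := e.exists_hasDepth_sent_of_fromKernel hj
        ((e.valid t j).echoPrime c u hs)
      exact ih t x hx hxs

theorem approved_eq_of_proposes (hQ : IsAsymQuorumSystem Fp Q)
    (hnaive : ∀ (B : Set P) (i : P), IsNaive Fp B i → ¬ HasDepth Q B 1 i)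
    (e : Execution Q F) {k : P} (hk : HasDepth Q F 4 k) {v : Bool}
    (hp : ∀ i, HasDepth Q F 2 i → e.Proposes i v) {t : ℕ} {i : P} (hi : HasDepth Q F 1 i)
    {u : Bool} (hu : u ∈ (e.conf t i).approved) : u = v := by
  by_contra huv
  obtain ⟨c, hc⟩ := (e.valid t i).approved u hu
  obtain ⟨j, hj, hs⟩ := e.exists_hasDepth_sent_of_fromQuorum hQ hnaive hi hk hc
  exact e.echo_not_mem_sent_of_proposes hQ hnaive hk huv hp c t j hj.of_succ hs

theorem decides_eq_of_proposes (hQ : IsAsymQuorumSystem Fp Q)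
    (hnaive : ∀ (B : Set P) (i : P), IsNaive Fp B i → ¬ HasDepth Q B 1 i)
    (e : Execution Q F) {v : Bool} (hp : ∀ i, HasDepth Q F 2 i → e.Proposes i v) {i : P}
    (hi : HasDepth Q F 4 i) {w : Option Bool} (hw : e.Decides i w) : w = some v := by
  have hi1 : HasDepth Q F 1 i := hi.mono (by norm_num)
  obtain ⟨t, ht⟩ := hw
  cases w with
  | none =>
    obtain ⟨a, ha, b, hb, hab⟩ := Finset.one_lt_card.1 ((e.valid t i).decision_none ht).1
    exact absurd ((e.approved_eq_of_proposes hQ hnaive hi hp hi1 ha).trans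
      (e.approved_eq_of_proposes hQ hnaive hi hp hi1 hb).symm) hab
  | some u =>
    obtain ⟨j, hj, hs⟩ := e.exists_hasDepth_sent_of_fromQuorum hQ hnaive hi1 hi
      ((e.valid t i).decision_some u ht)
    obtain ⟨x, hx, hxs⟩ := e.exists_hasDepth_sent_of_fromQuorum hQ hnaive
      (hj.mono (by norm_num)) hi ((e.valid t j).echo3_some u hs)
    rw [e.approved_eq_of_proposes hQ hnaive hi hp (hx.mono (by norm_num))
      ((e.valid t x).echo2 u hxs).1]

theorem decides_some_eq (hQ : IsAsymQuorumSystem Fp Q)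
    (hnaive : ∀ (B : Set P) (i : P), IsNaive Fp B i → ¬ HasDepth Q B 1 i)
    (e : Execution Q F) {i j : P} (hi : HasDepth Q F 1 i) (hj : HasDepth Q F 1 j) {v v' : Bool}
    (h : e.Decides i (some v)) (h' : e.Decides j (some v')) : v = v' := by
  obtain ⟨t, ht⟩ := h
  obtain ⟨t', ht'⟩ := h'
  obtain ⟨x, T, hx, hx'⟩ := e.exists_sent_of_fromQuorum_of_fromQuorum hQ hnaive hi hj
    ((e.valid t i).decision_some v ht) ((e.valid t' j).decision_some v' ht')
  simpa using (e.valid T x).echo3_unique _ _ hx hx'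

theorem echo3_some_eq (hQ : IsAsymQuorumSystem Fp Q)
    (hnaive : ∀ (B : Set P) (i : P), IsNaive Fp B i → ¬ HasDepth Q B 1 i)
    (e : Execution Q F) {t t' : ℕ} {i j : P} (hi : HasDepth Q F 1 i) (hj : HasDepth Q F 1 j)
    {v v' : Bool} (h : .echo3 (some v) ∈ (e.conf t i).sent)
    (h' : .echo3 (some v') ∈ (e.conf t' j).sent) : v = v' := by
  obtain ⟨x, T, hx, hx'⟩ := e.exists_sent_of_fromQuorum_of_fromQuorum hQ hnaive hi hj
    ((e.valid t i).echo3_some v h) ((e.valid t' j).echo3_some v' h')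
  exact (e.valid T x).echo2_unique _ _ hx hx'

/-- Once a process of depth `d + 2` has decided, one of the two binary values is excluded for all
processes of depth `d + 2`. -/
theorem exists_not_decides_of_extends (hQ : IsAsymQuorumSystem Fp Q)
    (hnaive : ∀ (B : Set P) (i : P), IsNaive Fp B i → ¬ HasDepth Q B 1 i)
    (e : Execution Q F) {d τ : ℕ} {i : P} (hi : HasDepth Q F (d + 2) i) {w : Option Bool}
    (hw : e.DecidedBy τ i w) :
    ∃ b : Bool, ∀ e' : Execution Q F, e'.Extends e τ →
      ∀ j, HasDepth Q F (d + 2) j → ¬ e'.Decides j (some (!b)) := by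
  have one_le {n : ℕ} {x : P} (hx : HasDepth Q F (n + 1) x) : HasDepth Q F 1 x :=
    hx.mono (Nat.le_add_left 1 n)
  cases w with
  | some v =>
    refine ⟨v, fun e' he' j hj hdec => ?_⟩
    have hv : e'.Decides i (some v) := ⟨τ, by rw [DecidedBy, he'.1 τ le_rfl]; exact hw⟩
    simpa using e'.decides_some_eq hQ hnaive (one_le hi) (one_le hj) hv hdec
  | none =>
    obtain ⟨-, q, hq, hm⟩ := (e.valid τ i).decision_none hw
    -- Any later decision quorum meets `q` in a process whose `echo3` message was already sent by
    -- time `τ`; as it sends only one, its value is the same in every extension.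
    have key (e' : Execution Q F) (he' : e'.Extends e τ) (j : P) (hj : HasDepth Q F (d + 2) j)
        (u : Bool) (hdec : e'.Decides j (some u)) :
        ∃ x ∈ q, HasDepth Q F (d + 1) x ∧ .echo3 (some u) ∈ (e.conf τ x).sent := by
      obtain ⟨t, ht⟩ := hdec
      obtain ⟨q', hq', hm'⟩ := (e'.valid t j).decision_some u ht
      obtain ⟨x, hx, hx', hxd⟩ := hQ.exists_hasDepth_mem_inter hnaive hi hj hq hq'
      obtain ⟨w, hw⟩ := hm x hx
      have hs := e.mem_sent_of_mem_received hxd.correct hw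
      have hs1 : .echo3 w ∈ (e'.conf (max t τ) x).sent :=
        (e'.conf_le x (le_max_right _ _)).sent (by rwa [he'.1 τ le_rfl])
      have hs2 := (e'.conf_le x (le_max_left t τ)).sent
        (e'.mem_sent_of_mem_received hxd.correct (hm' x hx'))
      rw [(e'.valid _ x).echo3_unique _ _ hs1 hs2] at hs
      exact ⟨x, hx, hxd, hs⟩
    by_cases h : ∃ v, ∃ y ∈ q, HasDepth Q F (d + 1) y ∧ .echo3 (some v) ∈ (e.conf τ y).sent
    · obtain ⟨v, y, -, hy, hys⟩ := h
      refine ⟨v, fun e' he' j hj hdec => ?_⟩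
      obtain ⟨x, -, hx, hxs⟩ := key e' he' j hj _ hdec
      simpa using e.echo3_some_eq hQ hnaive (one_le hy) (one_le hx) hys hxs
    -- Without a non-`⊥` `echo3` at depth `d + 1` in `q`, neither value can be decided, so the
    -- choice of `true` is arbitrary.
    · exact ⟨true, fun e' he' j hj hdec => h ⟨_, key e' he' j hj _ hdec⟩⟩

/-! ### Liveness -/

/-- Process `i` sends `m` in `e`. -/
def Sends (e : Execution Q F) (i : P) (m : Msg) : Prop :=
  ∃ t, m ∈ (e.conf t i).sent

/-- Process `i` approves `v` in `e`. -/
def Approves (e : Execution Q F) (i : P) (v : Bool) : Prop :=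
  ∃ t, v ∈ (e.conf t i).approved

variable {e : Execution Q F}

/-! ### Eventual delivery from quorums and kernels -/

theorem Fair.eventually_received (he : e.Fair) {i j : P} (hi : i ∉ F) (hj : j ∉ F) {m : Msg}
    (h : e.Sends j m) : ∀ᶠ t in Filter.atTop, (j, m) ∈ (e.conf t i).received := by
  obtain ⟨t, ht⟩ := h
  obtain ⟨t', ht'⟩ := he.delivery i j m t hi hj ht
  filter_upwards [Filter.eventually_ge_atTop t'] with s hs
  exact (e.conf_le i hs).received ht'

theorem Fair.exists_fromQuorum [Finite P] (he : e.Fair) {d : ℕ} {i : P}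
    (hi : HasDepth Q F (d + 1) i) {m : Msg} (h : ∀ j, HasDepth Q F d j → e.Sends j m) :
    ∃ t, (e.conf t i).FromQuorum (Q i) m := by
  obtain ⟨hiF, q, hq, hd⟩ := hi
  have := (Filter.eventually_all_finite q.toFinite).2 fun j hj =>
    he.eventually_received hiF (hd j hj).correct (h j (hd j hj))
  obtain ⟨t, ht⟩ := this.exists
  exact ⟨t, q, hq, ht⟩

theorem Fair.exists_anyEcho3FromQuorum [Finite P] (he : e.Fair) {d : ℕ} {i : P}
    (hi : HasDepth Q F (d + 1) i)
    (h : ∀ j, HasDepth Q F d j → ∃ w, e.Sends j (.echo3 w)) :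
    ∃ t, (e.conf t i).AnyEcho3FromQuorum (Q i) := by
  obtain ⟨hiF, q, hq, hd⟩ := hi
  have : ∀ j ∈ q, ∀ᶠ t in Filter.atTop, ∃ w, (j, .echo3 w) ∈ (e.conf t i).received := by
    intro j hj
    obtain ⟨w, hw⟩ := h j (hd j hj)
    exact (he.eventually_received hiF (hd j hj).correct hw).mono fun t ht => ⟨w, ht⟩
  obtain ⟨t, ht⟩ := ((Filter.eventually_all_finite q.toFinite).2 this).exists
  exact ⟨t, q, hq, ht⟩

theorem Fair.exists_fromKernel [Finite P] (he : e.Fair) {i : P} (hi : i ∉ F) {K : Set P}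
    (hK : IsKernel (Q i) K) {m : Msg} (h : ∀ j ∈ K, j ∉ F ∧ e.Sends j m) :
    ∃ t, (e.conf t i).FromKernel (Q i) m := by
  have := (Filter.eventually_all_finite K.toFinite).2 fun j hj =>
    he.eventually_received hi (h j hj).1 (h j hj).2
  obtain ⟨t, ht⟩ := this.exists
  exact ⟨t, K, hK, ht⟩

/-- A handler that stays enabled is executed. -/
theorem Fair.exists_conf_eq_apply (he : e.Fair) {i : P} (hi : i ∉ F) {r : Rule} {t : ℕ}
    (h : ∀ t' ≥ t, r.Guard (Q i) (e.conf t' i)) :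
    ∃ t' ≥ t, e.conf (t' + 1) i = r.apply (e.conf t' i) := by
  obtain ⟨t', ht', h' | h'⟩ := he.progress i r t hi (h t le_rfl)
  · exact ⟨t', ht', (e.step t' i _ h').2.2.1⟩
  · exact absurd (h t' ht') h'

/-! ### Eventual execution of the handlers -/

theorem Fair.sends_echoPrime (he : e.Fair) {i : P} (hi : i ∉ F) {c t : ℕ} {v : Bool}
    (h : (e.conf t i).FromKernel (Q i) (.echo c v)) : e.Sends i (.echoPrime c v) := by
  obtain ⟨t', -, ht'⟩ := he.exists_conf_eq_apply hi (r := .echoKernel c v) (t := t)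
    fun t' ht' => h.mono (e.conf_le i ht').received
  exact ⟨t' + 1, by simp [ht', Rule.apply]⟩

theorem Fair.sends_echo (he : e.Fair) {i : P} (hi : i ∉ F) {c t : ℕ} {v : Bool}
    (h : (e.conf t i).FromQuorum (Q i) (.echoPrime c v)) : e.Sends i (.echo (c + 1) v) := by
  obtain ⟨t', -, ht'⟩ := he.exists_conf_eq_apply hi (r := .echoPrimeQuorum c v) (t := t)
    fun t' ht' => h.mono (e.conf_le i ht').received
  exact ⟨t' + 1, by simp [ht', Rule.apply]⟩

theorem Fair.approves (he : e.Fair) {i : P} (hi : i ∉ F) {c t : ℕ} {v : Bool}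
    (h : (e.conf t i).FromQuorum (Q i) (.echo c v)) : e.Approves i v := by
  obtain ⟨t', -, ht'⟩ := he.exists_conf_eq_apply hi (r := .echoQuorum c v) (t := t)
    fun t' ht' => h.mono (e.conf_le i ht').received
  exact ⟨t' + 1, by simp [ht', Rule.apply]⟩

/-- The handler is disabled only by an earlier `echo3`, so a process that never sent one would have
to execute it. -/
theorem Fair.sends_echo3 (he : e.Fair) {i : P} (hi : i ∉ F) {t : ℕ} {v : Bool}
    (h : (e.conf t i).FromQuorum (Q i) (.echo2 v) ∨ 1 < (e.conf t i).approved.card) :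
    ∃ w, e.Sends i (.echo3 w) := by
  suffices ∃ t', (e.conf t' i).sentEcho3 = true by
    obtain ⟨t', ht'⟩ := this
    exact ((e.valid t' i).sentEcho3 ht').imp fun w hw => ⟨t', hw⟩
  by_contra! hno
  obtain ⟨t', -, ht'⟩ := he.exists_conf_eq_apply hi (r := .echo2Quorum v) (t := t)
    fun t' ht' => ⟨by simpa using hno t', h.imp (fun h => h.mono (e.conf_le i ht').received)
      fun h => h.trans_le (Finset.card_le_card (e.conf_le i ht').approved)⟩
  exact hno (t' + 1) (by simp [ht', Rule.apply])

theorem Fair.decides_of_fromQuorum (he : e.Fair) {i : P} (hi : i ∉ F) {t : ℕ} {v : Bool}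
    (h : (e.conf t i).FromQuorum (Q i) (.echo3 (some v))) : ∃ w, e.Decides i w := by
  by_contra hno
  have hnone : ∀ t', (e.conf t' i).decision = none := fun t' =>
    Option.eq_none_iff_forall_ne_some.2 fun w hw => hno ⟨w, t', hw⟩
  obtain ⟨t', -, ht'⟩ := he.exists_conf_eq_apply hi (r := .decideValue v) (t := t)
    fun t' ht' => ⟨hnone t', h.mono (e.conf_le i ht').received⟩
  have := hnone (t' + 1)
  simp [ht', Rule.apply] at this

theorem Fair.decides_of_anyEcho3FromQuorum (he : e.Fair) {i : P} (hi : i ∉ F) {t : ℕ}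
    (hc : 1 < (e.conf t i).approved.card) (h : (e.conf t i).AnyEcho3FromQuorum (Q i)) :
    ∃ w, e.Decides i w := by
  by_contra hno
  have hnone : ∀ t', (e.conf t' i).decision = none := fun t' =>
    Option.eq_none_iff_forall_ne_some.2 fun w hw => hno ⟨w, t', hw⟩
  obtain ⟨t', -, ht'⟩ := he.exists_conf_eq_apply hi (r := .decideBot) (t := t)
    fun t' ht' => ⟨hnone t', hc.trans_le (Finset.card_le_card (e.conf_le i ht').approved),
      h.mono (e.conf_le i ht').received,
      -- The guard of `decideBot` can also fail because a value is decidable, but then `decideValue`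
      -- produces a decision.
      fun ⟨v, hv⟩ => hno (he.decides_of_fromQuorum hi hv)⟩
  have := hnone (t' + 1)
  simp [ht', Rule.apply] at this

/-- A value approved by a process of positive depth is approved by all processes of depth `3`. -/
theorem Fair.approves_of_approves [Finite P] (hQ : IsAsymQuorumSystem Fp Q)
    (hnaive : ∀ (B : Set P) (i : P), IsNaive Fp B i → ¬ HasDepth Q B 1 i)
    (he : e.Fair) {i j : P} (hi : HasDepth Q F 1 i) (hj : HasDepth Q F 3 j) {v : Bool}
    (h : e.Approves i v) : e.Approves j v := by
  obtain ⟨t, ht⟩ := h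
  obtain ⟨c, q, hq, hm⟩ := (e.valid t i).approved v ht
  have h1 (k : P) (hk : HasDepth Q F 1 k) : e.Sends k (.echoPrime c v) := by
    -- The correct part of a quorum of one process of positive depth is a kernel for every other.
    -- Its members send their `echo` to all, so restarting from it costs no depth.
    have hK : IsKernel (Q k) (q \ F) := fun q' hq' => by
      obtain ⟨x, hx, hx', hxF⟩ := hQ.exists_hasDepth_mem_inter hnaive hi hk hq hq'
      exact ⟨x, ⟨hx, hxF⟩, hx'⟩
    obtain ⟨s, hs⟩ := he.exists_fromKernel hk.correct hK (m := .echo c v) fun x hx =>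
      ⟨hx.2, t, e.mem_sent_of_mem_received hx.2 (hm x hx.1)⟩
    exact he.sends_echoPrime hk.correct hs
  have h2 (k : P) (hk : HasDepth Q F 2 k) : e.Sends k (.echo (c + 1) v) :=
    let ⟨_, hs⟩ := he.exists_fromQuorum hk h1
    he.sends_echo hk.correct hs
  obtain ⟨s, hs⟩ := he.exists_fromQuorum hj h2
  exact he.approves hj.correct hs

/-- If all processes of depth `2` propose, then some value is proposed by a kernel for every process
of depth `3`, so that it is eventually approved. -/
theorem Fair.exists_approves [Finite P] (hQ : IsAsymQuorumSystem Fp Q)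
    (hnaive : ∀ (B : Set P) (i : P), IsNaive Fp B i → ¬ HasDepth Q B 1 i)
    (he : e.Fair) (hp : ∀ i, HasDepth Q F 2 i → ∃ v, e.Proposes i v) :
    ∃ v, ∀ i, HasDepth Q F 5 i → e.Approves i v := by
  obtain ⟨v, hv⟩ : ∃ v, ∀ i, HasDepth Q F 3 i →
      IsKernel (Q i) {j | HasDepth Q F 2 j ∧ e.Proposes j v} := by
    -- Otherwise one quorum avoids the depth-`2` proposers of `true` and another those of `false`;
    -- their common process of depth `2` proposes one of the two.
    by_contra! hno
    obtain ⟨i, hi, hKi⟩ := hno true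
    obtain ⟨j, hj, hKj⟩ := hno false
    simp only [IsKernel, not_forall] at hKi hKj
    obtain ⟨q, hq, hqi⟩ := hKi
    obtain ⟨q', hq', hqj⟩ := hKj
    obtain ⟨x, hx, hx', hxd⟩ := hQ.exists_hasDepth_mem_inter hnaive hi hj hq hq'
    obtain ⟨_ | _, hu⟩ := hp x hxd
    · exact hqj ⟨x, ⟨hxd, hu⟩, hx'⟩
    · exact hqi ⟨x, ⟨hxd, hu⟩, hx⟩
  have h3 (i : P) (hi : HasDepth Q F 3 i) : e.Sends i (.echoPrime 1 v) := by
    obtain ⟨t, ht⟩ := he.exists_fromKernel hi.correct (hv i hi) (m := .echo 1 v)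
      fun j ⟨hj, s, hs⟩ => ⟨hj.correct, s, (e.valid s j).input v hs⟩
    exact he.sends_echoPrime hi.correct ht
  have h4 (i : P) (hi : HasDepth Q F 4 i) : e.Sends i (.echo 2 v) :=
    let ⟨_, ht⟩ := he.exists_fromQuorum hi h3
    he.sends_echo hi.correct ht
  exact ⟨v, fun i hi =>
    let ⟨_, ht⟩ := he.exists_fromQuorum hi h4
    he.approves hi.correct ht⟩

/-! ### Decisions, according to whether both values are approved -/

theorem one_lt_card_approved_of_approves {i : P} (h : ∀ v, e.Approves i v) :
    ∃ t, 1 < (e.conf t i).approved.card := by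
  obtain ⟨t, ht⟩ := h true
  obtain ⟨t', ht'⟩ := h false
  exact ⟨max t t', Finset.one_lt_card.2 ⟨true, (e.conf_le i (le_max_left _ _)).approved ht,
    false, (e.conf_le i (le_max_right _ _)).approved ht', by simp⟩⟩

theorem Fair.decides_of_approves_all [Finite P] (he : e.Fair)
    (h : ∀ i, HasDepth Q F 3 i → ∀ v, e.Approves i v) {i : P} (hi : HasDepth Q F 4 i) :
    ∃ w, e.Decides i w := by
  have h3 (j : P) (hj : HasDepth Q F 3 j) : ∃ w, e.Sends j (.echo3 w) :=
    let ⟨_, ht⟩ := one_lt_card_approved_of_approves (h j hj)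
    he.sends_echo3 hj.correct (v := true) (.inr ht)
  obtain ⟨t, ht⟩ := one_lt_card_approved_of_approves (h i hi.of_succ)
  obtain ⟨t', ht'⟩ := he.exists_anyEcho3FromQuorum hi h3
  exact he.decides_of_anyEcho3FromQuorum hi.correct
    (ht.trans_le (Finset.card_le_card (e.conf_le i (le_max_left t t')).approved))
    (ht'.mono (e.conf_le i (le_max_right t t')).received)

/-- With a single value approved at positive depth, `echo2` is uniform at depth `3` and `echo3` at
depth `4`: an `echo3` of `⊥` would need two approved values, and one of another value an `echo2` for
it. -/
theorem Fair.decides_of_approves_only [Finite P] (hQ : IsAsymQuorumSystem Fp Q)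
    (hnaive : ∀ (B : Set P) (i : P), IsNaive Fp B i → ¬ HasDepth Q B 1 i)
    (he : e.Fair) {v : Bool} (h : ∀ i, HasDepth Q F 3 i → e.Approves i v)
    (honly : ∀ i u, HasDepth Q F 1 i → e.Approves i u → u = v) {i : P}
    (hi : HasDepth Q F 5 i) : ∃ w, e.Decides i w := by
  have h3 (j : P) (hj : HasDepth Q F 3 j) : e.Sends j (.echo2 v) := by
    obtain ⟨t, ht⟩ := h j hj
    obtain ⟨u, hu⟩ := (e.valid t j).sentEcho2 v ht
    rw [← honly j u (hj.mono (by norm_num)) ⟨t, ((e.valid t j).echo2 u hu).1⟩]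
    exact ⟨t, hu⟩
  have h4 (j : P) (hj : HasDepth Q F 4 j) : e.Sends j (.echo3 (some v)) := by
    have hj1 : HasDepth Q F 1 j := hj.mono (by norm_num)
    obtain ⟨t, ht⟩ := he.exists_fromQuorum hj h3
    obtain ⟨w, s, hs⟩ := he.sends_echo3 hj.correct (.inl ht)
    cases w with
    | none =>
      obtain ⟨a, ha, b, hb, hab⟩ := Finset.one_lt_card.1 ((e.valid s j).echo3_none hs)
      exact absurd ((honly j a hj1 ⟨s, ha⟩).trans (honly j b hj1 ⟨s, hb⟩).symm) hab
    | some u =>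
      obtain ⟨x, hx, hxs⟩ := e.exists_hasDepth_sent_of_fromQuorum hQ hnaive hj1 hj
        ((e.valid s j).echo3_some u hs)
      rw [← honly x u (hx.mono (by norm_num)) ⟨s, ((e.valid s x).echo2 u hxs).1⟩]
      exact ⟨s, hs⟩
  obtain ⟨t, ht⟩ := he.exists_fromQuorum hi h4
  exact he.decides_of_fromQuorum hi.correct ht

theorem Fair.decides [Finite P] (hQ : IsAsymQuorumSystem Fp Q)
    (hnaive : ∀ (B : Set P) (i : P), IsNaive Fp B i → ¬ HasDepth Q B 1 i)
    (he : e.Fair) (hp : ∀ i, HasDepth Q F 2 i → ∃ v, e.Proposes i v) {i : P}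
    (hi : HasDepth Q F 5 i) : ∃ w, e.Decides i w := by
  obtain ⟨v, hv⟩ := he.exists_approves hQ hnaive hp
  -- One approval at depth `5` is spread back to all of depth `3`, which regains two levels.
  have hv3 (j : P) (hj : HasDepth Q F 3 j) : e.Approves j v :=
    he.approves_of_approves hQ hnaive (hi.mono (by norm_num)) hj (hv i hi)
  by_cases h : ∃ j, HasDepth Q F 1 j ∧ e.Approves j (!v)
  · obtain ⟨j, hj, hja⟩ := h
    refine he.decides_of_approves_all (fun k hk u => ?_) hi.of_succ
    rcases Bool.eq_or_eq_not u v with rfl | rfl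
    · exact hv3 k hk
    · exact he.approves_of_approves hQ hnaive hj hk hja
  · refine he.decides_of_approves_only hQ hnaive hv3 (fun j u hj hju => ?_) hi
    rcases Bool.eq_or_eq_not u v with rfl | rfl
    · rfl
    · exact absurd ⟨j, hj, hju⟩ h

end Execution

end Executions

/-- Depth `6` leaves slack: the arguments need depth `5` for termination, `4` for validity, `1` for
agreement and `2` for binding. -/
theorem mainTheorem5 {P : Type*} [Finite P] (Fp Q : P → Set (Set P))
    (hQ : IsAsymQuorumSystem Fp Q)
    (hnaive : ∀ (B : Set P) (i : P), IsNaive Fp B i → ¬ HasDepth Q B 1 i)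
    (F : Set P) :
    SolvesBCA Q F 2 6 where
  termination _ he hp _ hi := he.decides hQ hnaive hp hi.of_succ
  validity e _ hp _ _ hi hw := e.decides_eq_of_proposes hQ hnaive hp (hi.mono (by norm_num)) hw
  agreement e i j w w' hi hj hw hw' := by
    rcases w with _ | v
    · exact .inr (.inl rfl)
    rcases w' with _ | v'
    · exact .inr (.inr rfl)
    exact .inl (congrArg some (e.decides_some_eq hQ hnaive (hi.mono (by norm_num))
      (hj.mono (by norm_num)) hw hw'))
  binding e _ hτ := by
    obtain ⟨⟨_, _, hi, hw⟩, -⟩ := hτ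
    exact e.exists_not_decides_of_extends hQ hnaive hi hw
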